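/- Let $n \ge 4$, let $\mathcal S_n$ be the group of permutations of $[n]=\{1,\dots,n\}$, and let $X_{i,j}$ ($1 \le i<j\le n$) be independent variables. For $\sigma \in \mathcal S_n$ put $\mathrm{INV}(\sigma)=\{(i,j) : i<j,\ \sigma(i)>\sigma(j)\}$ and $\mathrm{inv}_X(\sigma)=\sum_{(i,j)\in \mathrm{INV}(\sigma)} X_{i,j} \in \mathbb R[X_{1,2},\dots,X_{n-1,n}]$. Let $\mathfrak I_n=\big(\mathrm{inv}_X(\pi\tau^{-1})\big)_{\pi,\tau\in\mathcal S_n}$, regarded as a matrix over the field of rational functions $\mathbb R(X_{1,2},\dots,X_{n-1,n})$. Then $\mathfrak I_n$ is diagonalizable over this field, its spectrum is $\{\Omega,\,-\Lambda,\,-\Delta,\,0\}$, where $$\Omega=\frac{n!}{2}\sum_{1\le i<j\le n}X_{i,j},\qquad \Lambda=(n-2)!\sum_{1\le i<j\le n}(j-i)X_{i,j},\qquad \Delta=(n-3)!\sum_{1\le i<j\le n}\big(n-2(j-i)\big)X_{i,j},$$ and the multiplicities (algebraic and geometric) of the eigenvalues $\Omega$, $-\Lambda$, $-\Delta$ and $0$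 are, respectively, $1$, $n-1$, $\binom{n-1}{2}$ and $n!-\binom n2-1$. -/

import Mathlib

noncomputable section

namespace InvX

/-- The pairs `(i, j)` with `i < j`. The set `{1, …, n}` is modelled by `Fin n`. -/
abbrev Pairs (n : ℕ) : Type := {p : Fin n × Fin n // p.1 < p.2}

/-- The polynomial ring `ℝ[X_{i,j} : i < j]`, one variable for each pair. -/
abbrev Poly (n : ℕ) : Type := MvPolynomial (Pairs n) ℝ

/-- The field of fractions `ℝ(X_{i,j} : i < j)`. -/
abbrev RatFun (n : ℕ) : Type := FractionRing (Poly n)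

/-- The inversion set `INV(σ) = {(i, j) | i < j, σ(i) > σ(j)}`. -/
def INV {n : ℕ} (σ : Equiv.Perm (Fin n)) : Finset (Pairs n) :=
  Finset.univ.filter fun p => σ p.1.1 > σ p.1.2

/-- The multinomial inversion statistic `inv_X(σ) = ∑_{(i, j) ∈ INV(σ)} X_{i,j}`. -/
def invX {n : ℕ} (σ : Equiv.Perm (Fin n)) : Poly n :=
  ∑ p ∈ INV σ, MvPolynomial.X p

/-- The matrix `(inv_X(π τ⁻¹))` with rows `π` and columns `τ` in the symmetric group. -/
def invMatrix (n : ℕ) : Matrix (Equiv.Perm (Fin n)) (Equiv.Perm (Fin n)) (Poly n) :=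
  Matrix.of fun π τ => invX (π * τ⁻¹)

/-- The same matrix, with its entries seen in the field of fractions. -/
def invMatrixK (n : ℕ) : Matrix (Equiv.Perm (Fin n)) (Equiv.Perm (Fin n)) (RatFun n) :=
  (invMatrix n).map (algebraMap (Poly n) (RatFun n))

/-- `Ω = (n!/2) ∑_{i<j} X_{i,j}`. -/
def Omega (n : ℕ) : Poly n :=
  MvPolynomial.C (((Nat.factorial n : ℕ) : ℝ) / 2) * ∑ p : Pairs n, MvPolynomial.X p

/-- `Λ = (n-2)! ∑_{i<j} (j-i) X_{i,j}`. -/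
def Lambda (n : ℕ) : Poly n :=
  MvPolynomial.C ((Nat.factorial (n - 2) : ℕ) : ℝ) *
    ∑ p : Pairs n, MvPolynomial.C (((p.1.2 : ℕ) : ℝ) - ((p.1.1 : ℕ) : ℝ)) * MvPolynomial.X p

/-- `Δ = (n-3)! ∑_{i<j} (n - 2(j-i)) X_{i,j}`. -/
def Delta (n : ℕ) : Poly n :=
  MvPolynomial.C ((Nat.factorial (n - 3) : ℕ) : ℝ) *
    ∑ p : Pairs n,
      MvPolynomial.C ((n : ℝ) - 2 * (((p.1.2 : ℕ) : ℝ) - ((p.1.1 : ℕ) : ℝ))) * MvPolynomial.X p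

/-- A square matrix over a field is diagonalizable if it is similar to a diagonal matrix. -/
def Diagonalizable {K ι : Type*} [Field K] [Fintype ι] [DecidableEq ι]
    (M : Matrix ι ι K) : Prop :=
  ∃ (P : Matrix ι ι K) (d : ι → K), IsUnit P ∧ M * P = P * Matrix.diagonal d

/-- `a` is an eigenvalue of `M` of multiplicity `m`, both algebraically (as a root of the
characteristic polynomial) and geometrically (as the dimension of the eigenspace). -/
def HasMultiplicity {K ι : Type*} [Field K] [Fintype ι] [DecidableEq ι]
    (M : Matrix ι ι K) (a : K) (m : ℕ) : Prop :=
  M.charpoly.rootMultiplicity a = m ∧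
    Module.finrank K (Module.End.eigenspace (Matrix.toLin' M) a) = m

end InvX

end

/-!
Write `s(i, j)` for the sign of `i - j` and `x(i, j)` for the antisymmetric extension of the
variables, so `x(i, j) = X_{i,j}` for `i < j`. With `i = τ a` and `j = τ b`, the indicator of an
inversion of `π τ⁻¹` at `{i, j}` depends only on the relative order of `π a`, `π b` and of
`τ a`, `τ b`, and the matrix has the entries
`(∑_{i<j} X_{i,j}) / 2 + (1/4) ∑_{a,b} s(π a, π b) x(τ a, τ b)` (`weightedInvMatrix_apply`).
So it factors through the space of constants plus the space of antisymmetric functions of pairs,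
of dimension `1 + n.choose 2`, and its kernel has dimension at least `n! - n.choose 2 - 1`.

On the constants it acts by `Ω`. On antisymmetric functions, let `A = permSum s` and
`B = permMoment x`; up to the factor `1/4` the matrix acts on the range of `A` as `A ∘ B`, and
the nonzero eigenvalues of `A ∘ B` and `B ∘ A` agree. The matrix coefficients of `B ∘ A`, indexed
by two pairs of points, are invariant under relabelling the points, and antisymmetry together with
invariance leaves only two free parameters, which are found by averaging (`sum_perm_mul_eq`). As a result `B (A f)` at `(a, b)`
is a combination of `f(a, b)` and of the difference of the row sums of `f` at `a` and `b`
(`permMoment_permSum`). Its eigenfunctions are the differences `g(a) - g(b)`, a space of dimension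
`n - 1` giving `-Λ`, and the antisymmetric functions with vanishing row sums, a space of dimension
at least `(n - 1).choose 2` giving `-Δ`.

The four values are distinct, and these lower bounds for the dimensions of the eigenspaces add up
to `n!`. Since geometric multiplicities are at most algebraic ones, all the bounds are equalities
(`multiplicities_of_card_le`) and the matrix is diagonalizable (`diagonalizable_of_card_le`).
-/

namespace InvX

open Module Finset

/-! ### Eigenspaces that fill the space -/

section LinearAlgebra

variable {K ι κ : Type*} [Field K] [Fintype ι] [DecidableEq ι] [Fintype κ]

/-- Geometric multiplicities are at most algebraic ones, and the latter add up to at most the size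
of the matrix. So lower bounds for the former that add up to this size are sharp, and no further
eigenvalue exists. -/
theorem multiplicities_of_card_le (M : Matrix ι ι K) (μ : κ → K) (hμ : Function.Injective μ)
    (m : κ → ℕ) (hm : ∀ k, m k ≤ finrank K (End.eigenspace (Matrix.toLin' M) (μ k)))
    (hcard : Fintype.card ι ≤ ∑ k, m k) :
    (∀ k, HasMultiplicity M (μ k) (m k)) ∧ ∀ a, M.charpoly.IsRoot a → ∃ k, μ k = a := by
  classical
  have hga : ∀ k, finrank K (End.eigenspace (Matrix.toLin' M) (μ k)) ≤
      M.charpoly.rootMultiplicity (μ k) := fun k => by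
    have h := LinearMap.finrank_eigenspace_le (Matrix.toLin' M) (μ k)
    rwa [Matrix.charpoly_toLin'] at h
  have hroots : ∀ s : Finset K,
      ∑ a ∈ s, M.charpoly.rootMultiplicity a ≤ Fintype.card ι := fun s => by
    simp only [← Polynomial.count_roots]
    calc ∑ a ∈ s, M.charpoly.roots.count a
        ≤ ∑ a ∈ s ∪ M.charpoly.roots.toFinset, M.charpoly.roots.count a :=
          sum_le_sum_of_subset subset_union_left
      _ = M.charpoly.roots.card := Multiset.sum_count_eq_card fun a ha =>
          mem_union_right _ (Multiset.mem_toFinset.2 ha)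
      _ ≤ M.charpoly.natDegree := Polynomial.card_roots' _
      _ = Fintype.card ι := M.charpoly_natDegree_eq_dim
  have himg : ∑ a ∈ univ.image μ, M.charpoly.rootMultiplicity a =
      ∑ k, M.charpoly.rootMultiplicity (μ k) := sum_image fun x _ y _ h => hμ h
  have hle : ∀ k ∈ univ, m k ≤ M.charpoly.rootMultiplicity (μ k) :=
    fun k _ => (hm k).trans (hga k)
  have hsum : ∑ k, m k = ∑ k, M.charpoly.rootMultiplicity (μ k) :=
    le_antisymm (sum_le_sum hle) ((himg ▸ hroots (univ.image μ)).trans hcard)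
  have heq := (sum_eq_sum_iff_of_le hle).1 hsum
  refine ⟨fun k => ⟨(heq k (mem_univ k)).symm, le_antisymm ?_ (hm k)⟩, fun a ha => ?_⟩
  · exact (hga k).trans (heq k (mem_univ k)).ge
  · by_contra! hne
    -- A further root would push the total multiplicity above the size of the matrix.
    have h1 := hroots (insert a (univ.image μ))
    rw [sum_insert (by simpa using hne), himg, ← hsum] at h1
    have h2 := (Polynomial.rootMultiplicity_pos M.charpoly_monic.ne_zero).2 ha
    omega

theorem diagonalizable_of_card_le (M : Matrix ι ι K) (μ : κ → K) (hμ : Function.Injective μ)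
    (hcard : Fintype.card ι ≤ ∑ k, finrank K (End.eigenspace (Matrix.toLin' M) (μ k))) :
    Diagonalizable M := by
  classical
  set E : κ → Submodule K (ι → K) := fun k => End.eigenspace (Matrix.toLin' M) (μ k) with hE
  have hind : iSupIndep E := (End.eigenspaces_iSupIndep (Matrix.toLin' M)).comp hμ
  have hinj : Function.Injective (DirectSum.coeLinearMap E) := hind.dfinsupp_lsum_injective
  have hfin : finrank K (DirectSum κ fun k => E k) = finrank K (ι → K) := by
    refine le_antisymm (LinearMap.finrank_le_finrank_of_injective hinj) ?_
    rw [finrank_directSum, finrank_fintype_fun_eq_card]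
    exact hcard
  have hint : DirectSum.IsInternal E :=
    ⟨hinj, (LinearMap.injective_iff_surjective_of_finrank_eq_finrank hfin).1 hinj⟩
  let b₀ := hint.collectedBasis fun k => finBasis K (E k)
  let e : (Σ k, Fin (finrank K (E k))) ≃ ι := b₀.indexEquiv (Pi.basisFun K ι)
  let b : Basis ι K (ι → K) := b₀.reindex e
  have hb : ∀ i, M.mulVec (b i) = μ (e.symm i).1 • b i := fun i => by
    have h := hint.collectedBasis_mem (fun k => finBasis K (E k)) (e.symm i)
    have h' := End.mem_eigenspace_iff.1 h
    rw [Matrix.toLin'_apply] at h'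
    simpa [b, b₀] using h'
  refine ⟨(Pi.basisFun K ι).toMatrix b, fun i => μ (e.symm i).1, ?_, ?_⟩
  · exact IsUnit.of_mul_eq_one _ ((Pi.basisFun K ι).toMatrix_mul_toMatrix_flip b)
  · ext i j
    rw [Matrix.mul_diagonal, Matrix.mul_apply]
    have h := congrFun (hb j) i
    simp only [Matrix.mulVec, dotProduct, Pi.smul_apply, smul_eq_mul] at h
    simp only [Basis.toMatrix_apply, Pi.basisFun_repr]
    rw [h, mul_comm]

end LinearAlgebra

/-! ### Sums over permutations of antisymmetric functions -/

theorem factorial_sub_two {K : Type*} [CommRing K] {n : ℕ} (hn : 3 ≤ n) :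
    ((n - 2).factorial : K) = (n - 2) * ((n - 3).factorial : K) := by
  obtain ⟨m, rfl⟩ := Nat.exists_eq_add_of_le' hn
  rw [show m + 3 - 2 = m + 1 by omega, show m + 3 - 3 = m by omega, Nat.factorial_succ]
  push_cast
  ring

theorem choose_two_eq_add {n : ℕ} (hn : 1 ≤ n) : n.choose 2 = (n - 1) + (n - 1).choose 2 := by
  obtain ⟨m, rfl⟩ := Nat.exists_eq_add_of_le' hn
  simp [Nat.choose_succ_succ']

section PermSums

variable {K α : Type*} [Field K] [Fintype α] [DecidableEq α]

theorem sum_perm_mul_swap (F : Equiv.Perm α → K) (a b : α) :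
    ∑ τ, F (τ * Equiv.swap a b) = ∑ τ, F τ :=
  Equiv.sum_comp (Equiv.mulRight (Equiv.swap a b)) F

/-- The substitution `τ ↦ τ * swap a b` changes the sign of the sum. -/
theorem sum_perm_antisymm [CharZero K] {x : α → α → K} (hx : ∀ i j, x j i = -x i j) (a b : α) :
    ∑ τ : Equiv.Perm α, x (τ a) (τ b) = 0 := by
  have h := sum_perm_mul_swap (fun τ => x (τ a) (τ b)) a b
  simp only [Equiv.Perm.mul_apply, Equiv.swap_apply_left, Equiv.swap_apply_right] at h
  rw [sum_congr rfl fun τ _ => hx (τ a) (τ b), sum_neg_distrib] at h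
  exact self_eq_neg.1 h.symm

/-- The symmetric group is doubly transitive, so the sum does not depend on the pair of distinct
points. -/
theorem sum_perm_pair_eq (F : α → α → K) {a b a' b' : α} (hab : a ≠ b) (hab' : a' ≠ b') :
    ∑ τ : Equiv.Perm α, F (τ a) (τ b) = ∑ τ : Equiv.Perm α, F (τ a') (τ b') := by
  obtain ⟨ρ, h1, h2⟩ : ∃ ρ : Equiv.Perm α, ρ a = a' ∧ ρ b = b' := by
    have h := MulAction.is_two_pretransitive_iff.1
      (Equiv.Perm.isMultiplyPretransitive α 2) hab hab'
    simpa using h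
  rw [← Equiv.sum_comp (Equiv.mulRight ρ) fun τ : Equiv.Perm α => F (τ a) (τ b)]
  simp [h1, h2]

/-- The sum does not depend on `a ≠ b`, so it is its average over all such pairs. -/
theorem sum_perm_pair [CharZero K] {F : α → α → K} (hF : ∀ i, F i i = 0) {a b : α}
    (hab : a ≠ b) :
    ∑ τ : Equiv.Perm α, F (τ a) (τ b) =
      ((Fintype.card α - 2).factorial : K) * ∑ i, ∑ j, F i j := by
  set N := Fintype.card α with hN
  have hN2 : 2 ≤ N := Fintype.one_lt_card_iff.2 ⟨a, b, hab⟩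
  set C := ∑ τ : Equiv.Perm α, F (τ a) (τ b) with hC
  -- The sum over all `c`, `d` is computed in two ways; the diagonal contributes nothing.
  have h1 : ∑ c, ∑ d, ∑ τ : Equiv.Perm α, F (τ c) (τ d) =
      (N.factorial : K) * ∑ i, ∑ j, F i j := by
    calc ∑ c, ∑ d, ∑ τ : Equiv.Perm α, F (τ c) (τ d)
        = ∑ τ : Equiv.Perm α, ∑ c, ∑ d, F (τ c) (τ d) := by
          simp_rw [sum_comm (s := univ (α := α)) (t := univ (α := Equiv.Perm α))]
      _ = ∑ τ : Equiv.Perm α, ∑ i, ∑ j, F i j := by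
          refine sum_congr rfl fun τ _ => ?_
          rw [← Equiv.sum_comp τ fun i => ∑ j, F i j]
          exact sum_congr rfl fun c _ => Equiv.sum_comp τ (F (τ c))
      _ = _ := by simp [Fintype.card_perm, hN]
  have h2 : ∑ c, ∑ d, ∑ τ : Equiv.Perm α, F (τ c) (τ d) = (N * (N - 1 : ℕ) : K) * C := by
    have h3 : ∀ c : α, ∑ d, ∑ τ : Equiv.Perm α, F (τ c) (τ d) = ((N - 1 : ℕ) : K) * C := by
      intro c
      rw [← add_sum_erase _ _ (mem_univ c)]
      rw [sum_congr rfl fun d hd =>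
        sum_perm_pair_eq F (Finset.ne_of_mem_erase hd).symm hab]
      simp [hF, card_erase_of_mem, hN, hC]
    rw [sum_congr rfl fun c _ => h3 c]
    simp [hN, mul_assoc]
  have h4 : (N.factorial : K) = (N * (N - 1 : ℕ) : K) * ((N - 2).factorial : K) := by
    obtain ⟨m, hm⟩ := Nat.exists_eq_add_of_le hN2
    rw [hm, show 2 + m = m + 1 + 1 by ring, Nat.factorial_succ, Nat.factorial_succ]
    simp [mul_assoc]
  have h5 : (N * (N - 1 : ℕ) : K) ≠ 0 := by
    have : N * (N - 1) ≠ 0 := Nat.mul_ne_zero (by omega) (by omega)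
    exact_mod_cast this
  apply mul_left_cancel₀ h5
  rw [← h2, h1, h4, mul_assoc]

/-- The linear map `f ↦ (π ↦ ∑_{a,b} s(π a, π b) f(a, b))` from functions of pairs to functions
of permutations. -/
def permSum (s : α → α → K) : (α → α → K) →ₗ[K] (Equiv.Perm α → K) where
  toFun f π := ∑ a, ∑ b, s (π a) (π b) * f a b
  map_add' f g := by ext π; simp [mul_add, sum_add_distrib]
  map_smul' c f := by ext π; simp [mul_sum, mul_left_comm]

/-- The transpose of `permSum x`: the linear map `v ↦ ((a, b) ↦ ∑_τ x(τ a, τ b) v(τ))`. -/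
def permMoment (x : α → α → K) : (Equiv.Perm α → K) →ₗ[K] (α → α → K) where
  toFun v a b := ∑ τ : Equiv.Perm α, x (τ a) (τ b) * v τ
  map_add' f g := by ext a b; simp [mul_add, sum_add_distrib]
  map_smul' c f := by ext a b; simp [mul_sum, mul_left_comm]

theorem permMoment_antisymm {x : α → α → K} (hx : ∀ i j, x j i = -x i j)
    (v : Equiv.Perm α → K) (a b : α) : permMoment x v b a = -permMoment x v a b := by
  simp only [permMoment, LinearMap.coe_mk, AddHom.coe_mk, ← sum_neg_distrib]
  exact sum_congr rfl fun τ _ => by rw [hx (τ a) (τ b), neg_mul]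

variable [CharZero K]

theorem sum_permSum {s : α → α → K} (hs : ∀ i j, s j i = -s i j) (f : α → α → K) :
    ∑ π, permSum s f π = 0 := by
  simp only [permSum, LinearMap.coe_mk, AddHom.coe_mk]
  rw [sum_comm]
  refine sum_eq_zero fun a _ => ?_
  rw [sum_comm]
  refine sum_eq_zero fun b _ => ?_
  rw [← sum_mul, sum_perm_antisymm hs, zero_mul]

theorem permMoment_one {x : α → α → K} (hx : ∀ i j, x j i = -x i j) :
    permMoment x 1 = 0 := by
  ext a b
  simpa [permMoment] using sum_perm_antisymm hx a b

/-- The matrix coefficient of `permMoment x ∘ permSum s` at row `(a, b)` and column `(c, d)`. It is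
antisymmetric in `c` and `d`, it vanishes if `{c, d}` and `{a, b}` are disjoint, and for fixed
`a ≠ b` it is determined by its value at `(a, b)` and its common value at all `(a, d)` with
`d ≠ a, b`. -/
theorem sum_perm_mul_eq {x s : α → α → K} (hx : ∀ i j, x j i = -x i j)
    (hs : ∀ i j, s j i = -s i j) (hN : 3 ≤ Fintype.card α) {a b : α} (hab : a ≠ b) (c d : α) :
    ∑ τ : Equiv.Perm α, x (τ a) (τ b) * s (τ c) (τ d) =
      ((Fintype.card α - 3).factorial : K) *
        (∑ i, ∑ j, x i j * ∑ k, s i k - ∑ i, ∑ j, x i j * s i j) *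
        (((Pi.single a 1 : α → K) c - (Pi.single b 1 : α → K) c) -
          ((Pi.single a 1 : α → K) d - (Pi.single b 1 : α → K) d)) +
      ((Fintype.card α - 3).factorial : K) *
        (Fintype.card α * ∑ i, ∑ j, x i j * s i j - 2 * ∑ i, ∑ j, x i j * ∑ k, s i k) *
        ((Pi.single a 1 : α → K) c * (Pi.single b 1 : α → K) d -
          (Pi.single b 1 : α → K) c * (Pi.single a 1 : α → K) d) := by
  set S := ∑ i, ∑ j, x i j * s i j with hS
  set R := ∑ i, ∑ j, x i j * ∑ k, s i k with hR
  set N := Fintype.card α with hNdef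
  have hx0 : ∀ i, x i i = 0 := fun i => self_eq_neg.1 (hx i i)
  set k : α → α → K := fun c d => ∑ τ : Equiv.Perm α, x (τ a) (τ b) * s (τ c) (τ d) with hk
  have hkanti : ∀ c d, k d c = -k c d := fun c d => by
    simp only [hk, ← sum_neg_distrib]
    exact sum_congr rfl fun τ _ => by rw [hs (τ c) (τ d)]; ring
  have hk0 : ∀ c, k c c = 0 := fun c => self_eq_neg.1 (hkanti c c)
  have hfact : ((N - 2).factorial : K) = (N - 2) * ((N - 3).factorial : K) :=
    factorial_sub_two hN
  have hN0 : (N : K) - 2 ≠ 0 := by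
    rw [sub_ne_zero]
    exact_mod_cast (by omega : N ≠ 2)
  -- The value of `k` at `(a, b)` and its row sum at `a` involve two points only.
  have hβ : k a b = ((N - 2).factorial : K) * S :=
    sum_perm_pair (F := fun i j => x i j * s i j) (by simp [hx0]) hab
  have hγ : ∑ d, k a d = ((N - 2).factorial : K) * R := by
    rw [← sum_perm_pair (F := fun i j => x i j * ∑ l, s i l) (by simp [hx0]) hab, sum_comm]
    refine sum_congr rfl fun τ _ => ?_
    rw [← mul_sum, Equiv.sum_comp τ (s (τ a))]
  -- If `c` and `d` avoid `a` and `b`, swapping them changes the sign.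
  have hdisj : ∀ c d, c ≠ a → c ≠ b → d ≠ a → d ≠ b → k c d = 0 := fun c d h1 h2 h3 h4 => by
    have h := sum_perm_mul_swap (fun τ => x (τ a) (τ b) * s (τ c) (τ d)) c d
    simp only [Equiv.Perm.mul_apply, Equiv.swap_apply_left, Equiv.swap_apply_right,
      Equiv.swap_apply_of_ne_of_ne h1.symm h3.symm,
      Equiv.swap_apply_of_ne_of_ne h2.symm h4.symm] at h
    exact self_eq_neg.1 (h.symm.trans (hkanti c d))
  -- Swapping `d` and `d'` fixes `a` and `b`, so the values at `(a, d)` and `(a, d')` agree.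
  have hconst : ∀ d d', d ≠ a → d ≠ b → d' ≠ a → d' ≠ b → k a d = k a d' :=
    fun d d' h1 h2 h3 h4 => by
    have h := sum_perm_mul_swap (fun τ => x (τ a) (τ b) * s (τ a) (τ d')) d d'
    simp only [Equiv.Perm.mul_apply, Equiv.swap_apply_right,
      Equiv.swap_apply_of_ne_of_ne h1.symm h3.symm,
      Equiv.swap_apply_of_ne_of_ne h2.symm h4.symm] at h
    exact h
  -- The row sum at `a` consists of the value at `(a, b)` and `N - 2` equal terms.
  have ha : ∀ d, d ≠ a → d ≠ b → k a d = ((N - 3).factorial : K) * (R - S) := fun d h1 h2 => by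
    rw [← add_sum_erase _ _ (mem_univ a), ← add_sum_erase _ _ (mem_erase.2 ⟨hab.symm, mem_univ b⟩),
      sum_congr rfl fun d' hd' => hconst d' d (by simp at hd'; tauto) (by simp at hd'; tauto) h1 h2,
      hk0, hβ, sum_const, card_erase_of_mem (mem_erase.2 ⟨hab.symm, mem_univ b⟩),
      card_erase_of_mem (mem_univ a), card_univ, ← hNdef, nsmul_eq_mul, Nat.sub_sub,
      Nat.cast_sub (by omega), hfact] at hγ
    apply mul_left_cancel₀ hN0
    push_cast at hγ
    linear_combination hγ
  -- Swapping `a` and `b` turns the row at `b` into minus the row at `a`.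
  have hb : ∀ d, d ≠ a → d ≠ b → k b d = -(((N - 3).factorial : K) * (R - S)) :=
    fun d h1 h2 => by
    have h := sum_perm_mul_swap (fun τ => x (τ a) (τ b) * s (τ b) (τ d)) a b
    simp only [Equiv.Perm.mul_apply, Equiv.swap_apply_left, Equiv.swap_apply_right,
      Equiv.swap_apply_of_ne_of_ne h1 h2] at h
    rw [← ha d h1 h2]
    refine h.symm.trans ?_
    simp only [hk, ← sum_neg_distrib]
    exact sum_congr rfl fun τ _ => by rw [hx (τ a) (τ b)]; ring
  have hβ' : k a b = (N - 2) * ((N - 3).factorial : K) * S := by rw [hβ, hfact]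
  change k c d = _
  by_cases hca : c = a
  · subst hca
    by_cases hda : d = c
    · subst hda; simp [hk0]
    by_cases hdb : d = b
    · subst hdb; simp [hβ', hab, hab.symm]; ring
    · simp [ha d hda hdb, hda, hdb, hab]
  by_cases hcb : c = b
  · subst hcb
    by_cases hda : d = a
    · subst hda; simp [hkanti d c, hβ', hab, hab.symm]; ring
    by_cases hdb : d = c
    · subst hdb; simp [hk0]
    · simp [hb d hda hdb, hda, hdb, hca]
  by_cases hda : d = a
  · subst hda
    simp [hkanti d c, ha c hca hcb, hca, hcb, hab]
  by_cases hdb : d = b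
  · subst hdb
    simp [hkanti d c, hb c hca hcb, hca, hcb, hda]
  · simp [hdisj c d hca hcb hda hdb, hca, hcb, hda, hdb]

/-- On an antisymmetric `f`, the composite `permMoment x ∘ permSum s` is a combination of `f` and of
the differences of the row sums of `f`. -/
theorem permMoment_permSum {x s : α → α → K} (hx : ∀ i j, x j i = -x i j)
    (hs : ∀ i j, s j i = -s i j) (hN : 3 ≤ Fintype.card α) {f : α → α → K}
    (hf : ∀ i j, f j i = -f i j) (a b : α) :
    permMoment x (permSum s f) a b =
      2 * (((Fintype.card α - 3).factorial : K) *
        (∑ i, ∑ j, x i j * ∑ k, s i k - ∑ i, ∑ j, x i j * s i j)) *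
          (∑ c, f a c - ∑ c, f b c) +
      2 * (((Fintype.card α - 3).factorial : K) *
        (Fintype.card α * ∑ i, ∑ j, x i j * s i j - 2 * ∑ i, ∑ j, x i j * ∑ k, s i k)) *
          f a b := by
  by_cases hab : a = b
  · subst hab
    have h1 : permMoment x (permSum s f) a a = 0 :=
      self_eq_neg.1 (permMoment_antisymm hx _ a a)
    rw [h1, self_eq_neg.1 (hf a a)]
    ring
  have hcol : ∀ e, ∑ c, f c e = -∑ c, f e c := fun e => by
    rw [← sum_neg_distrib]; exact sum_congr rfl fun c _ => hf e c
  have h1 : permMoment x (permSum s f) a b =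
      ∑ c, ∑ d, (∑ τ : Equiv.Perm α, x (τ a) (τ b) * s (τ c) (τ d)) * f c d := by
    simp only [permMoment, permSum, LinearMap.coe_mk, AddHom.coe_mk, mul_sum, sum_mul]
    rw [sum_comm]
    refine sum_congr rfl fun c _ => ?_
    rw [sum_comm]
    exact sum_congr rfl fun d _ => sum_congr rfl fun τ _ => by ring
  rw [h1]
  simp_rw [sum_perm_mul_eq hx hs hN hab]
  generalize ((Fintype.card α - 3).factorial : K) *
        (∑ i, ∑ j, x i j * ∑ k, s i k - ∑ i, ∑ j, x i j * s i j) = p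
  generalize ((Fintype.card α - 3).factorial : K) *
        (Fintype.card α * ∑ i, ∑ j, x i j * s i j - 2 * ∑ i, ∑ j, x i j * ∑ k, s i k) = q
  have e1 : ∀ e, ∑ c, (Pi.single e 1 : α → K) c * ∑ d, f c d = ∑ d, f e d := fun e => by
    simp [Pi.single_apply]
  have e2 : ∀ e, ∑ c, ∑ d, (Pi.single e 1 : α → K) d * f c d = -∑ d, f e d := fun e => by
    simp [Pi.single_apply, hcol]
  have e3 : ∀ e e', ∑ c, ∑ d, (Pi.single e 1 : α → K) c * (Pi.single e' 1 : α → K) d * f c d =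
      f e e' :=
    fun e e' => by simp [Pi.single_apply]
  have h2 : ∀ c d, (p * (((Pi.single a 1 : α → K) c - (Pi.single b 1 : α → K) c) -
      ((Pi.single a 1 : α → K) d - (Pi.single b 1 : α → K) d)) +
      q * ((Pi.single a 1 : α → K) c * (Pi.single b 1 : α → K) d -
          (Pi.single b 1 : α → K) c * (Pi.single a 1 : α → K) d)) * f c d =
      p * ((Pi.single a 1 : α → K) c * f c d) - p * ((Pi.single b 1 : α → K) c * f c d) -
      p * ((Pi.single a 1 : α → K) d * f c d) + p * ((Pi.single b 1 : α → K) d * f c d) +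
      q * ((Pi.single a 1 : α → K) c * (Pi.single b 1 : α → K) d * f c d) -
      q * ((Pi.single b 1 : α → K) c * (Pi.single a 1 : α → K) d * f c d) := fun c d => by ring
  rw [sum_congr rfl fun c _ => sum_congr rfl fun d _ => h2 c d]
  simp only [sum_add_distrib, sum_sub_distrib, ← mul_sum,
    e1, e2, e3, hf a b]
  ring

end PermSums

/-! ### Antisymmetric functions on ordered pairs -/

section Pairs

variable {K : Type*} [Field K] {n : ℕ}

/-- A double sum without diagonal terms, grouped by unordered pairs. -/
theorem sum_sum_eq_sum_pairs (F : Fin n → Fin n → K) (hF : ∀ i, F i i = 0) :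
    ∑ i, ∑ j, F i j = ∑ p : Pairs n, (F p.1.1 p.1.2 + F p.1.2 p.1.1) := by
  have h1 : ∀ G : Fin n → Fin n → K,
      ∑ p : Pairs n, G p.1.1 p.1.2 = ∑ i, ∑ j, if i < j then G i j else 0 := fun G => by
    rw [← Fintype.sum_prod_type' fun i j => if i < j then G i j else 0, ← sum_filter]
    exact (sum_subtype (univ.filter fun q : Fin n × Fin n => q.1 < q.2) (by simp)
      fun q => G q.1 q.2).symm
  rw [sum_add_distrib, h1 F, h1 fun i j => F j i,
    sum_comm (f := fun i j => if i < j then F j i else 0), ← sum_add_distrib]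
  refine sum_congr rfl fun i _ => ?_
  rw [← sum_add_distrib]
  refine sum_congr rfl fun j _ => ?_
  rcases lt_trichotomy i j with h | h | h
  · simp [h, h.not_gt]
  · subst h; simp [hF]
  · simp [h, h.not_gt]

theorem card_pairs : Fintype.card (Pairs n) = n.choose 2 := by
  have h := sum_sum_eq_sum_pairs (n := n) (fun i j => if i = j then (0 : ℚ) else 1) (by simp)
  have h1 : ∀ i : Fin n, ∑ j, (if i = j then (0 : ℚ) else 1) = n - 1 := fun i => by
    have h2 : ∀ j, (if i = j then (0 : ℚ) else 1) = 1 - if i = j then 1 else 0 := fun j => by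
      split_ifs <;> simp
    simp [h2]
  have h3 : ∀ p : Pairs n, (if p.1.1 = p.1.2 then (0 : ℚ) else 1) +
      (if p.1.2 = p.1.1 then (0 : ℚ) else 1) = 2 := fun p => by
    rw [if_neg p.2.ne, if_neg p.2.ne']; norm_num
  rw [sum_congr rfl fun i _ => h1 i, sum_congr rfl fun p _ => h3 p] at h
  simp only [sum_const, card_univ, nsmul_eq_mul, Fintype.card_fin] at h
  have h4 : (Fintype.card (Pairs n) : ℚ) = n.choose 2 := by
    rw [Nat.cast_choose_two]; linarith
  exact_mod_cast h4

/-- The antisymmetric extension to all ordered pairs of a function of the pairs `i < j`. -/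
def antisymmExt : (Pairs n → K) →ₗ[K] (Fin n → Fin n → K) where
  toFun f i j := if h : i < j then f ⟨(i, j), h⟩ else if h : j < i then -f ⟨(j, i), h⟩ else 0
  map_add' f g := by ext i j; simp only [Pi.add_apply]; split_ifs <;> simp [add_comm]
  map_smul' c f := by ext i j; simp only [Pi.smul_apply]; split_ifs <;> simp

theorem antisymmExt_fst_snd (f : Pairs n → K) (p : Pairs n) :
    antisymmExt f p.1.1 p.1.2 = f p := by
  simp [antisymmExt, p.2]

theorem antisymmExt_swap (f : Pairs n → K) (i j : Fin n) :
    antisymmExt f j i = -antisymmExt f i j := by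
  rcases lt_trichotomy i j with h | h | h
  · simp [antisymmExt, h, h.not_gt]
  · subst h; simp [antisymmExt]
  · simp [antisymmExt, h, h.not_gt]

theorem antisymmExt_self (f : Pairs n → K) (i : Fin n) : antisymmExt f i i = 0 := by
  simp [antisymmExt]

theorem antisymmExt_injective : Function.Injective (antisymmExt (K := K) (n := n)) :=
  fun f g h => funext fun p => by rw [← antisymmExt_fst_snd f, h, antisymmExt_fst_snd]

theorem sum_antisymmExt_mul_eq (y : Pairs n → K) (G : Fin n → Fin n → K) :
    ∑ i, ∑ j, antisymmExt y i j * G i j =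
      ∑ p : Pairs n, y p * (G p.1.1 p.1.2 - G p.1.2 p.1.1) := by
  rw [sum_sum_eq_sum_pairs _ (by simp [antisymmExt_self])]
  refine sum_congr rfl fun p _ => ?_
  rw [antisymmExt_swap y p.1.1 p.1.2, antisymmExt_fst_snd]
  ring

/-- The sign `1` for `i > j`, `-1` for `i < j` and `0` for `i = j`. -/
def orderSign : Fin n → Fin n → K := antisymmExt fun _ => -1

theorem orderSign_eq (i j : Fin n) :
    (orderSign i j : K) = if i < j then -1 else if j < i then 1 else 0 := by
  simp [orderSign, antisymmExt]

theorem orderSign_swap (i j : Fin n) : (orderSign j i : K) = -orderSign i j :=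
  antisymmExt_swap _ i j

/-- With indices from `0`, there are `i` indices below `i` and `n - 1 - i` above it. -/
theorem sum_orderSign (i : Fin n) : ∑ j, (orderSign i j : K) = 2 * (i : ℕ) + 1 - n := by
  have h : ∀ j, (orderSign i j : K) = (if j ∈ Iio i then 1 else 0) - if j ∈ Ioi i then 1 else 0 :=
    fun j => by
    rw [orderSign_eq]
    rcases lt_trichotomy i j with h | h | h
    · simp [h, h.not_gt]
    · subst h; simp
    · simp [h, h.not_gt]
  simp only [h, sum_sub_distrib, sum_ite_mem, univ_inter, sum_const, Fin.card_Iio, Fin.card_Ioi,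
    nsmul_eq_mul, mul_one]
  rw [Nat.sub_sub, Nat.cast_sub (by omega)]
  push_cast
  ring

theorem sum_antisymmExt_mul_orderSign (y : Pairs n → K) :
    ∑ i, ∑ j, antisymmExt y i j * orderSign i j = -2 * ∑ p, y p := by
  rw [sum_antisymmExt_mul_eq, mul_sum]
  refine sum_congr rfl fun p _ => ?_
  rw [orderSign_swap p.1.1 p.1.2, orderSign, antisymmExt_fst_snd]
  ring

theorem sum_antisymmExt_mul_sum_orderSign (y : Pairs n → K) :
    ∑ i, ∑ j, antisymmExt y i j * ∑ k, orderSign i k =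
      -2 * ∑ p : Pairs n, (((p.1.2 : ℕ) : K) - ((p.1.1 : ℕ) : K)) * y p := by
  rw [sum_antisymmExt_mul_eq y fun i _ => ∑ k, orderSign i k, mul_sum]
  refine sum_congr rfl fun p _ => ?_
  rw [sum_orderSign, sum_orderSign]
  ring

end Pairs

/-! ### Eigenspaces of the weighted inversion matrix -/

section Eigenspaces

variable {K : Type*} [Field K] [CharZero K] {n : ℕ}

/-- The matrix `(∑_{(i,j) ∈ INV(π τ⁻¹)} y_{i,j})` for arbitrary weights `y` in a field. -/
def weightedInvMatrix (y : Pairs n → K) : Matrix (Equiv.Perm (Fin n)) (Equiv.Perm (Fin n)) K :=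
  Matrix.of fun π τ => ∑ p ∈ INV (π * τ⁻¹), y p

/-- The indicator of `σ i > σ j` is `(1 + s(σ i, σ j)) / 2`. The sum on the right runs over ordered
pairs, hence the denominator `4`. -/
theorem weightedInvMatrix_apply (y : Pairs n → K) (π τ : Equiv.Perm (Fin n)) :
    weightedInvMatrix y π τ = (∑ p, y p) / 2 +
      (∑ a, ∑ b, orderSign (π a) (π b) * antisymmExt y (τ a) (τ b)) / 4 := by
  have h1 : ∑ a, ∑ b, orderSign (π a) (π b) * antisymmExt y (τ a) (τ b) =
      ∑ i, ∑ j, antisymmExt y i j * orderSign ((π * τ⁻¹) i) ((π * τ⁻¹) j) := by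
    rw [← Equiv.sum_comp τ fun i => ∑ j, antisymmExt y i j *
      orderSign ((π * τ⁻¹) i) ((π * τ⁻¹) j)]
    refine sum_congr rfl fun a _ => ?_
    rw [← Equiv.sum_comp τ fun j => antisymmExt y (τ a) j *
      orderSign ((π * τ⁻¹) (τ a)) ((π * τ⁻¹) j)]
    exact sum_congr rfl fun b _ => by simp [mul_comm]
  have h2 : ∀ p : Pairs n, y p * (orderSign ((π * τ⁻¹) p.1.1) ((π * τ⁻¹) p.1.2) -
      orderSign ((π * τ⁻¹) p.1.2) ((π * τ⁻¹) p.1.1)) =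
      4 * (if (π * τ⁻¹) p.1.1 > (π * τ⁻¹) p.1.2 then y p else 0) - 2 * y p := fun p => by
    have hne : (π * τ⁻¹) p.1.1 ≠ (π * τ⁻¹) p.1.2 := fun h => p.2.ne ((π * τ⁻¹).injective h)
    rw [orderSign_eq, orderSign_eq]
    rcases hne.lt_or_gt with h | h
    · simp only [h, h.not_gt, if_true, if_false]; ring
    · simp only [h, h.not_gt, if_true, if_false]; ring
  rw [h1, sum_antisymmExt_mul_eq y fun i j => orderSign ((π * τ⁻¹) i) ((π * τ⁻¹) j),
    sum_congr rfl fun p _ => h2 p, sum_sub_distrib, ← mul_sum, ← mul_sum, ← sum_filter]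
  simp only [weightedInvMatrix, INV, Matrix.of_apply]
  ring

theorem toLin'_weightedInvMatrix (y : Pairs n → K) (v : Equiv.Perm (Fin n) → K) :
    Matrix.toLin' (weightedInvMatrix y) v =
      ((∑ p, y p) / 2 * ∑ τ, v τ) • (1 : Equiv.Perm (Fin n) → K) +
        (1 / 4 : K) • permSum orderSign (permMoment (antisymmExt y) v) := by
  ext π
  simp only [Matrix.toLin'_apply, Matrix.mulVec, dotProduct, weightedInvMatrix_apply, permSum,
    permMoment, LinearMap.coe_mk, AddHom.coe_mk, Pi.add_apply, Pi.smul_apply, Pi.one_apply,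
    smul_eq_mul, add_mul, sum_add_distrib, mul_sum, sum_mul, sum_div]
  congr 1
  · exact sum_congr rfl fun τ _ => by simp
  · rw [sum_comm]
    refine sum_congr rfl fun a _ => ?_
    rw [sum_comm]
    exact sum_congr rfl fun b _ => sum_congr rfl fun τ _ => by ring

theorem toLin'_weightedInvMatrix_one (y : Pairs n → K) :
    Matrix.toLin' (weightedInvMatrix y) 1 = ((n.factorial : K) / 2 * ∑ p, y p) • 1 := by
  rw [toLin'_weightedInvMatrix, permMoment_one (antisymmExt_swap y), map_zero, smul_zero, add_zero]
  congr 1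
  simp [Fintype.card_perm]
  ring

/-- On the range of `permSum orderSign` the rank-one part vanishes, because its elements have sum
zero. -/
theorem toLin'_weightedInvMatrix_permSum (y : Pairs n → K) (f : Fin n → Fin n → K) :
    Matrix.toLin' (weightedInvMatrix y) (permSum orderSign f) =
      (1 / 4 : K) • permSum orderSign (permMoment (antisymmExt y) (permSum orderSign f)) := by
  rw [toLin'_weightedInvMatrix, sum_permSum orderSign_swap, mul_zero, zero_smul, zero_add]

/-- Antisymmetric functions with vanishing row sums are eigenfunctions. -/
theorem permMoment_permSum_of_sum_eq_zero (hn : 3 ≤ n) (y : Pairs n → K) {f : Fin n → Fin n → K}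
    (hf : ∀ i j, f j i = -f i j) (hrow : ∀ i, ∑ j, f i j = 0) :
    permMoment (antisymmExt y) (permSum orderSign f) =
      (4 * -(((n - 3).factorial : K) *
        ∑ p : Pairs n, (n - 2 * (((p.1.2 : ℕ) : K) - ((p.1.1 : ℕ) : K))) * y p)) • f := by
  ext a b
  rw [permMoment_permSum (antisymmExt_swap y) orderSign_swap (by simpa using hn) hf,
    sum_antisymmExt_mul_orderSign, sum_antisymmExt_mul_sum_orderSign]
  simp only [hrow, Fintype.card_fin, Pi.smul_apply, smul_eq_mul, sub_mul, sum_sub_distrib,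
    mul_assoc, ← mul_sum]
  ring

/-- The functions `g i - g j` are eigenfunctions: their row sums are `n * g i - ∑ j, g j`, and the
constant cancels in differences. -/
theorem permMoment_permSum_sub (hn : 3 ≤ n) (y : Pairs n → K) (g : Fin n → K) :
    permMoment (antisymmExt y) (permSum orderSign fun i j => g i - g j) =
      (4 * -(((n - 2).factorial : K) *
        ∑ p : Pairs n, (((p.1.2 : ℕ) : K) - ((p.1.1 : ℕ) : K)) * y p)) •
        fun i j => g i - g j := by
  ext a b
  rw [permMoment_permSum (antisymmExt_swap y) orderSign_swap (by simpa using hn) (by simp),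
    sum_antisymmExt_mul_orderSign, sum_antisymmExt_mul_sum_orderSign, factorial_sub_two hn]
  simp only [Fintype.card_fin, Pi.smul_apply, smul_eq_mul, sum_sub_distrib, sum_const, card_univ,
    nsmul_eq_mul]
  ring

theorem one_le_finrank_eigenspace (y : Pairs n → K) :
    1 ≤ finrank K (End.eigenspace (Matrix.toLin' (weightedInvMatrix y))
      ((n.factorial : K) / 2 * ∑ p, y p)) := by
  rw [Submodule.one_le_finrank_iff, Submodule.ne_bot_iff]
  exact ⟨1, End.mem_eigenspace_iff.2 (toLin'_weightedInvMatrix_one y), one_ne_zero⟩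

/-- `permSum` carries eigenfunctions of `B ∘ A` to eigenvectors of `A ∘ B`, where `A` is
`permSum orderSign` and `B` is `permMoment (antisymmExt y)`. -/
theorem permSum_mem_eigenspace {y : Pairs n → K} {f : Fin n → Fin n → K} {c : K}
    (h : permMoment (antisymmExt y) (permSum orderSign f) = (4 * c) • f) :
    permSum orderSign f ∈ End.eigenspace (Matrix.toLin' (weightedInvMatrix y)) c := by
  rw [End.mem_eigenspace_iff, toLin'_weightedInvMatrix_permSum, h, map_smul, smul_smul]
  congr 1
  ring

/-- `permSum` is injective on the eigenfunctions of `permMoment ∘ permSum` with nonzero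
eigenvalue. -/
theorem eq_zero_of_permSum_eq_zero {y : Pairs n → K} {f : Fin n → Fin n → K} {c : K} (hc : c ≠ 0)
    (h : permMoment (antisymmExt y) (permSum orderSign f) = (4 * c) • f)
    (h0 : permSum orderSign f = 0) : f = 0 := by
  rw [h0, map_zero] at h
  exact (smul_eq_zero.1 h.symm).resolve_left (by simpa using hc)

theorem le_finrank_eigenspace_differences (hn : 3 ≤ n) (y : Pairs n → K) {c : K}
    (hc : c = -(((n - 2).factorial : K) *
      ∑ p : Pairs n, (((p.1.2 : ℕ) : K) - ((p.1.1 : ℕ) : K)) * y p)) (hc0 : c ≠ 0) :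
    n - 1 ≤ finrank K (End.eigenspace (Matrix.toLin' (weightedInvMatrix y)) c) := by
  let D : (Fin n → K) →ₗ[K] (Fin n → Fin n → K) :=
    { toFun := fun g i j => g i - g j
      map_add' := fun f g => by ext i j; simp; ring
      map_smul' := fun r f => by ext i j; simp; ring }
  have hD : ∀ g, permMoment (antisymmExt y) (permSum orderSign (D g)) = (4 * c) • D g :=
    fun g => hc ▸ permMoment_permSum_sub hn y g
  set Φ := permSum (K := K) (orderSign (n := n)) ∘ₗ D
  have hrange : LinearMap.range Φ ≤ End.eigenspace (Matrix.toLin' (weightedInvMatrix y)) c := by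
    rintro _ ⟨g, rfl⟩
    exact permSum_mem_eigenspace (hD g)
  -- As the eigenvalue is nonzero, only constant `g` are sent to zero.
  have hker : LinearMap.ker Φ ≤ K ∙ (1 : Fin n → K) := fun g hg => by
    have h := eq_zero_of_permSum_eq_zero hc0 (hD g) (LinearMap.mem_ker.1 hg)
    refine Submodule.mem_span_singleton.2 ⟨g ⟨0, by omega⟩, funext fun i => ?_⟩
    have h1 : g i - g ⟨0, by omega⟩ = 0 := congrFun (congrFun h i) ⟨0, by omega⟩
    simpa using (sub_eq_zero.1 h1).symm
  have h1 := LinearMap.finrank_range_add_finrank_ker Φ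
  have : Nonempty (Fin n) := ⟨⟨0, by omega⟩⟩
  have h2 := (Submodule.finrank_mono hker).trans
    (finrank_span_singleton (one_ne_zero : (1 : Fin n → K) ≠ 0)).le
  have h3 := Submodule.finrank_mono hrange
  rw [finrank_fintype_fun_eq_card, Fintype.card_fin] at h1
  omega

theorem le_finrank_eigenspace_zero_row_sums (hn : 3 ≤ n) (y : Pairs n → K) {c : K}
    (hc : c = -(((n - 3).factorial : K) *
      ∑ p : Pairs n, (n - 2 * (((p.1.2 : ℕ) : K) - ((p.1.1 : ℕ) : K))) * y p)) (hc0 : c ≠ 0) :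
    (n - 1).choose 2 ≤ finrank K (End.eigenspace (Matrix.toLin' (weightedInvMatrix y)) c) := by
  let r : (Pairs n → K) →ₗ[K] (Fin n → K) :=
    { toFun := fun f i => ∑ j, antisymmExt f i j
      map_add' := fun f g => by ext i; simp [sum_add_distrib]
      map_smul' := fun a f => by ext i; simp [mul_sum] }
  -- The row sums of an antisymmetric function add up to zero, so `r` misses the vector `1`.
  have hr : LinearMap.range r ≠ ⊤ := fun h => by
    obtain ⟨f, hf⟩ : (1 : Fin n → K) ∈ LinearMap.range r := h ▸ Submodule.mem_top
    have h1 : ∑ i, r f i = 0 := by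
      change ∑ i, ∑ j, antisymmExt f i j = 0
      rw [sum_sum_eq_sum_pairs _ (antisymmExt_self f)]
      exact sum_eq_zero fun p _ => by rw [antisymmExt_swap f p.1.1 p.1.2, add_neg_cancel]
    rw [hf] at h1
    simp only [Pi.one_apply, sum_const, card_univ, Fintype.card_fin, nsmul_eq_mul, mul_one,
      Nat.cast_eq_zero] at h1
    omega
  have hlt := Submodule.finrank_lt hr
  have hE : ∀ f ∈ LinearMap.ker r,
      permMoment (antisymmExt y) (permSum orderSign (antisymmExt f)) = (4 * c) • antisymmExt f :=
    fun f hf => hc ▸ permMoment_permSum_of_sum_eq_zero hn y (antisymmExt_swap f)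
      fun i => congrFun (LinearMap.mem_ker.1 hf) i
  let Φ : LinearMap.ker r →ₗ[K] End.eigenspace (Matrix.toLin' (weightedInvMatrix y)) c :=
    LinearMap.codRestrict _ (permSum orderSign ∘ₗ antisymmExt ∘ₗ (LinearMap.ker r).subtype)
      fun f => permSum_mem_eigenspace (hE f f.2)
  have hΦ : Function.Injective Φ := (injective_iff_map_eq_zero Φ).2 fun f hf => by
    have h := eq_zero_of_permSum_eq_zero hc0 (hE f f.2) (congrArg Subtype.val hf)
    exact Subtype.ext (antisymmExt_injective (h.trans (map_zero _).symm))
  have h1 := LinearMap.finrank_range_add_finrank_ker r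
  have h2 := LinearMap.finrank_le_finrank_of_injective hΦ
  rw [finrank_fintype_fun_eq_card, card_pairs] at h1
  rw [finrank_fintype_fun_eq_card, Fintype.card_fin] at hlt
  have h3 := choose_two_eq_add (by omega : 1 ≤ n)
  omega

/-- The matrix factors through a space of dimension `1 + n.choose 2`. -/
theorem le_finrank_eigenspace_zero (y : Pairs n → K) :
    n.factorial - n.choose 2 - 1 ≤
      finrank K (End.eigenspace (Matrix.toLin' (weightedInvMatrix y)) 0) := by
  let B : (Equiv.Perm (Fin n) → K) →ₗ[K] K × (Pairs n → K) :=
    { toFun := fun v => (∑ τ, v τ, fun p => permMoment (antisymmExt y) v p.1.1 p.1.2)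
      map_add' := fun v w => by ext <;> simp [sum_add_distrib]
      map_smul' := fun a v => by ext <;> simp [mul_sum] }
  have hker : LinearMap.ker B ≤ End.eigenspace (Matrix.toLin' (weightedInvMatrix y)) 0 :=
    fun v hv => by
    have hv' := LinearMap.mem_ker.1 hv
    have h1 : ∑ τ, v τ = 0 := congrArg Prod.fst hv'
    have h2 : ∀ p : Pairs n, permMoment (antisymmExt y) v p.1.1 p.1.2 = 0 :=
      fun p => congrFun (congrArg Prod.snd hv') p
    have h3 : permMoment (antisymmExt y) v = 0 := by
      ext a b
      have hanti := permMoment_antisymm (antisymmExt_swap y) v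
      rcases lt_trichotomy a b with h | h | h
      · exact h2 ⟨(a, b), h⟩
      · subst h; exact self_eq_neg.1 (hanti a a)
      · rw [hanti b a, h2 ⟨(b, a), h⟩]; simp
    rw [End.mem_eigenspace_iff, toLin'_weightedInvMatrix, h1, h3]
    simp
  have h1 := LinearMap.finrank_range_add_finrank_ker B
  have h2 := Submodule.finrank_le (LinearMap.range B)
  have h3 := Submodule.finrank_mono hker
  rw [finrank_fintype_fun_eq_card, Fintype.card_perm, Fintype.card_fin] at h1
  rw [finrank_prod, finrank_self, finrank_fintype_fun_eq_card, card_pairs] at h2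
  omega

end Eigenspaces

/-! ### The eigenvalues as rational functions -/

theorem invMatrixK_eq (n : ℕ) : invMatrixK n =
    weightedInvMatrix fun p => algebraMap (Poly n) (RatFun n) (MvPolynomial.X p) := by
  ext π τ
  simp [invMatrixK, invMatrix, weightedInvMatrix, invX]

theorem algebraMap_Omega (n : ℕ) : algebraMap (Poly n) (RatFun n) (Omega n) =
    (n.factorial : RatFun n) / 2 *
      ∑ p, algebraMap (Poly n) (RatFun n) (MvPolynomial.X p) := by
  have h : (MvPolynomial.C ((n.factorial : ℝ) / 2) : Poly n) * 2 = n.factorial := by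
    rw [← map_natCast MvPolynomial.C, ← map_ofNat MvPolynomial.C 2, ← map_mul]
    simp
  have h2 := congrArg (algebraMap (Poly n) (RatFun n)) h
  rw [map_mul, map_natCast, map_ofNat] at h2
  rw [Omega, map_mul, map_sum, ← h2, mul_div_cancel_right₀ _ two_ne_zero]

theorem algebraMap_Lambda (n : ℕ) : algebraMap (Poly n) (RatFun n) (-Lambda n) =
    -(((n - 2).factorial : RatFun n) * ∑ p : Pairs n,
      (((p.1.2 : ℕ) : RatFun n) - ((p.1.1 : ℕ) : RatFun n)) *
        algebraMap (Poly n) (RatFun n) (MvPolynomial.X p)) := by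
  simp only [Lambda, map_neg, map_mul, map_sum, map_sub, map_natCast]

theorem algebraMap_Delta (n : ℕ) : algebraMap (Poly n) (RatFun n) (-Delta n) =
    -(((n - 3).factorial : RatFun n) * ∑ p : Pairs n,
      (n - 2 * (((p.1.2 : ℕ) : RatFun n) - ((p.1.1 : ℕ) : RatFun n))) *
        algebraMap (Poly n) (RatFun n) (MvPolynomial.X p)) := by
  simp only [Delta, map_neg, map_mul, map_sum, map_sub, map_natCast, map_ofNat]

theorem eval_single_Omega {n : ℕ} (p : Pairs n) :
    MvPolynomial.eval (Pi.single p 1) (Omega n) = (n.factorial : ℝ) / 2 := by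
  simp [Omega, Pi.single_apply]

theorem eval_single_Lambda {n : ℕ} (p : Pairs n) :
    MvPolynomial.eval (Pi.single p 1) (Lambda n) =
      ((n - 2).factorial : ℝ) * (((p.1.2 : ℕ) : ℝ) - ((p.1.1 : ℕ) : ℝ)) := by
  simp [Lambda, Pi.single_apply]

theorem eval_single_Delta {n : ℕ} (p : Pairs n) :
    MvPolynomial.eval (Pi.single p 1) (Delta n) =
      ((n - 3).factorial : ℝ) * (n - 2 * (((p.1.2 : ℕ) : ℝ) - ((p.1.1 : ℕ) : ℝ))) := by
  simp [Delta, Pi.single_apply]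

theorem injective_vec_four {β : Type*} {a b c d : β} (hab : a ≠ b) (hac : a ≠ c) (had : a ≠ d)
    (hbc : b ≠ c) (hbd : b ≠ d) (hcd : c ≠ d) : Function.Injective ![a, b, c, d] := by
  intro i j hij
  fin_cases i <;> fin_cases j <;>
    simp_all [hab.symm, hac.symm, had.symm, hbc.symm, hbd.symm, hcd.symm]

/-- The values are separated by their coefficients at `X_{1,2}`, where `Λ` and `Δ` agree, and at
`X_{1,3}`. -/
theorem eigenvalues_injective {n : ℕ} (hn : 4 ≤ n) :
    Function.Injective ![Omega n, -Lambda n, -Delta n, 0] := by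
  -- Evaluation at `Pi.single p 1` extracts the coefficient of `X_p` of a linear form.
  let p : Pairs n := ⟨(⟨0, by omega⟩, ⟨1, by omega⟩), Fin.mk_lt_mk.2 (by omega)⟩
  let q : Pairs n := ⟨(⟨0, by omega⟩, ⟨2, by omega⟩), Fin.mk_lt_mk.2 (by omega)⟩
  have h0 : (0 : ℝ) < ((n - 3).factorial : ℝ) := by exact_mod_cast Nat.factorial_pos _
  have h1 : (0 : ℝ) < (n.factorial : ℝ) := by exact_mod_cast Nat.factorial_pos _
  have hn' : (4 : ℝ) ≤ n := by exact_mod_cast hn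
  have hpΩ := eval_single_Omega p
  have hpΛ := eval_single_Lambda p
  have hpΔ := eval_single_Delta p
  have hqΛ := eval_single_Lambda q
  have hqΔ := eval_single_Delta q
  rw [factorial_sub_two (by omega)] at hpΛ hqΛ
  simp only [p, q, Nat.cast_zero, Nat.cast_one, Nat.cast_ofNat] at hpΛ hpΔ hqΛ hqΔ
  generalize ((n - 3).factorial : ℝ) = c at h0 hpΛ hpΔ hqΛ hqΔ
  generalize (n.factorial : ℝ) = w at h1 hpΩ
  have hm : 4 * c ≤ n * c := mul_le_mul_of_nonneg_right hn' h0.le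
  have hΩΛ : Omega n ≠ -Lambda n := fun h => by
    have h' := congrArg (MvPolynomial.eval (Pi.single p 1)) h
    rw [map_neg, hpΩ, hpΛ] at h'
    linarith
  have hΩΔ : Omega n ≠ -Delta n := fun h => by
    have h' := congrArg (MvPolynomial.eval (Pi.single p 1)) h
    rw [map_neg, hpΩ, hpΔ] at h'
    linarith
  have hΩ0 : Omega n ≠ 0 := fun h => by
    have h' := congrArg (MvPolynomial.eval (Pi.single p 1)) h
    rw [map_zero, hpΩ] at h'
    linarith
  have hΛΔ : -Lambda n ≠ -Delta n := fun h => by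
    have h' := congrArg (MvPolynomial.eval (Pi.single q 1)) h
    rw [map_neg, map_neg, hqΛ, hqΔ] at h'
    linarith
  have hΛ0 : -Lambda n ≠ 0 := fun h => by
    have h' := congrArg (MvPolynomial.eval (Pi.single p 1)) h
    rw [map_neg, map_zero, hpΛ] at h'
    linarith
  have hΔ0 : -Delta n ≠ 0 := fun h => by
    have h' := congrArg (MvPolynomial.eval (Pi.single p 1)) h
    rw [map_neg, map_zero, hpΔ] at h'
    linarith
  exact injective_vec_four hΩΛ hΩΔ hΩ0 hΛΔ hΛ0 hΔ0

/-- The multiplicity of the eigenvalue `0` is positive. -/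
theorem choose_two_add_one_lt_factorial {n : ℕ} (hn : 4 ≤ n) : n.choose 2 + 1 < n.factorial := by
  obtain ⟨m, rfl⟩ := Nat.exists_eq_add_of_le' hn
  have h1 : (m + 4).choose 2 * 2 = (m + 4) * (m + 3) := by
    rw [Nat.choose_two_right, Nat.div_mul_cancel (Nat.even_mul_pred_self _).two_dvd]
    rfl
  have h2 : (m + 4).factorial = (m + 4) * ((m + 3) * ((m + 2) * (m + 1).factorial)) := by
    simp [Nat.factorial_succ]
  have h3 : 1 ≤ (m + 1).factorial := Nat.factorial_pos _
  have h4 : (m + 4) * ((m + 3) * (2 * 1)) ≤ (m + 4).factorial := by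
    rw [h2]; gcongr; omega
  nlinarith

end InvX

theorem theorem2 (n : ℕ) (hn : 4 ≤ n) :
    InvX.Diagonalizable (InvX.invMatrixK n) ∧
    spectrum (InvX.RatFun n) (InvX.invMatrixK n) =
      {algebraMap (InvX.Poly n) (InvX.RatFun n) (InvX.Omega n),
        algebraMap (InvX.Poly n) (InvX.RatFun n) (-InvX.Lambda n),
        algebraMap (InvX.Poly n) (InvX.RatFun n) (-InvX.Delta n),
        0} ∧
    InvX.HasMultiplicity (InvX.invMatrixK n)
      (algebraMap (InvX.Poly n) (InvX.RatFun n) (InvX.Omega n)) 1 ∧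
    InvX.HasMultiplicity (InvX.invMatrixK n)
      (algebraMap (InvX.Poly n) (InvX.RatFun n) (-InvX.Lambda n)) (n - 1) ∧
    InvX.HasMultiplicity (InvX.invMatrixK n)
      (algebraMap (InvX.Poly n) (InvX.RatFun n) (-InvX.Delta n)) ((n - 1).choose 2) ∧
    InvX.HasMultiplicity (InvX.invMatrixK n) 0 (Nat.factorial n - n.choose 2 - 1) := by
  open InvX in
  set y : Pairs n → RatFun n := fun p => algebraMap (Poly n) (RatFun n) (MvPolynomial.X p) with hy
  have hM : invMatrixK n = weightedInvMatrix y := invMatrixK_eq n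
  let μ : Fin 4 → RatFun n := algebraMap (Poly n) (RatFun n) ∘
    ![Omega n, -Lambda n, -Delta n, 0]
  have hμ : Function.Injective μ :=
    (IsFractionRing.injective (Poly n) (RatFun n)).comp (eigenvalues_injective hn)
  have hμ3 : μ 3 = 0 := map_zero _
  let m : Fin 4 → ℕ := ![1, n - 1, (n - 1).choose 2, n.factorial - n.choose 2 - 1]
  have hm : ∀ k, m k ≤ Module.finrank (RatFun n)
      (Module.End.eigenspace (Matrix.toLin' (invMatrixK n)) (μ k)) := by
    rw [hM]
    intro k
    fin_cases k
    · have h := one_le_finrank_eigenspace y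
      rwa [← algebraMap_Omega] at h
    · exact le_finrank_eigenspace_differences (by omega) y (algebraMap_Lambda n)
        fun h => absurd (hμ (a₁ := 1) (a₂ := 3) (h.trans hμ3.symm)) (by decide)
    · exact le_finrank_eigenspace_zero_row_sums (by omega) y (algebraMap_Delta n)
        fun h => absurd (hμ (a₁ := 2) (a₂ := 3) (h.trans hμ3.symm)) (by decide)
    · have h := le_finrank_eigenspace_zero y
      rwa [← hμ3] at h
  have hlt := choose_two_add_one_lt_factorial hn
  have hcard : Fintype.card (Equiv.Perm (Fin n)) ≤ ∑ k, m k := by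
    have h := choose_two_eq_add (by omega : 1 ≤ n)
    rw [Fintype.card_perm, Fintype.card_fin, Fin.sum_univ_four]
    simp only [m, Matrix.cons_val]
    omega
  obtain ⟨hmult, hroot⟩ := multiplicities_of_card_le (invMatrixK n) μ hμ m hm hcard
  have hpos : ∀ k, 0 < m k := fun k => by
    have : 0 < (n - 1).choose 2 := Nat.choose_pos (by omega)
    fin_cases k <;> simp [m] <;> omega
  refine ⟨diagonalizable_of_card_le (invMatrixK n) μ hμ
    (hcard.trans (Finset.sum_le_sum fun k _ => hm k)), ?_, hmult 0, hmult 1, hmult 2, ?_⟩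
  · have hrange : Set.range μ = spectrum (RatFun n) (invMatrixK n) := by
      ext a
      rw [Matrix.mem_spectrum_iff_isRoot_charpoly]
      refine ⟨?_, hroot a⟩
      rintro ⟨k, rfl⟩
      rw [← Polynomial.rootMultiplicity_pos (Matrix.charpoly_monic _).ne_zero, (hmult k).1]
      exact hpos k
    rw [← hrange, Set.range_comp]
    simp only [Matrix.range_cons, Matrix.range_empty, Set.union_empty, Set.singleton_union,
      Set.image_insert_eq, Set.image_singleton, map_zero]
  · have h := hmult 3
    rwa [hμ3] at h
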